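/- Let $n\ge d\ge 2$ be integers. A combinatorial prediction game is given by a nonempty action set $\mathcal S\subseteq\{0,1\}^d$ and is played for $n$ rounds. In each round $t=1,\dots,n$ the forecaster chooses, possibly at random, an action $V_t\in\mathcal S$ on the basis of its past actions and observations; simultaneously the adversary chooses a loss vector $\ell_t\in[0,\infty)^d$, which may depend on $V_1,\dots,V_{t-1}$; the forecaster incurs the loss $\ell_t^{T}V_t$ and then observes - the vector $\ell_t$ in the full-information game, - the coordinates $\ell_{i,t}\mathbf 1_{\{V_{i,t}=1\}}$, $i=1,\dots,d$, in the semi-bandit game, - the number $\ell_t^{T}V_t$ in the bandit game. The adversary is an $L_2$ adversary if $\ell_t^{T}v\le 1$ for all $t$ and all $v\in\mathcal S$. The regret is $$\overline R_n=\mathbb E\sum_{t=1}^n \ell_t^{T}V_t-\min_{v\in\mathcal S}\mathbb E\sum_{t=1}^n \ell_t^{T}v ,$$ where the expectation is over the randomization of the forecaster. For each of the three games let $$R_n=\max_{\emptyset\ne\mathcal S\subseteq\{0,1\}^d}\ \inf\ \sup\ \overline R_n ,$$ with the infimum over all forecaster strategies for this game and the supremum over all $L_2$ adversaries. Then $$R_n\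 \ge\ 0.05\,\sqrt{dn}$$ in the full-information game and in the semi-bandit game, and $$R_n\ \ge\ 0.05\,\min\bigl(n,\ d\sqrt n\bigr)$$ in the bandit game. The same bounds hold if the supremum is restricted to any class of $L_2$ adversaries that contains all oblivious ones, i.e. all those whose loss vectors $\ell_1,\dots,\ell_n$ form a fixed sequence. -/

import Mathlib

noncomputable section

namespace CombGame

/-- Points of the hypercube `{0,1}^d` (`true` stands for `1`). -/
abbrev Action (d : ℕ) : Type := Fin d → Bool

/-- The linear loss `ℓᵀ v`. -/
def loss {d : ℕ} (l : Fin d → ℝ) (v : Action d) : ℝ := ∑ i, if v i then l i else 0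

/-- The three feedback models. -/
inductive Game : Type
  | fullInfo
  | semiBandit
  | bandit

/-- The type of what the forecaster is shown after a round. -/
def Game.Obs (d : ℕ) : Game → Type
  | .fullInfo => Fin d → ℝ
  | .semiBandit => Fin d → ℝ
  | .bandit => ℝ

/-- What the forecaster is shown after having played `v` against the loss vector `l`: the vector
`l`, or the coordinates `l i * 1_{v i = 1}`, or the number `lᵀ v`. -/
def Game.observe {d : ℕ} : (g : Game) → Action d → (Fin d → ℝ) → g.Obs d
  | .fullInfo, _, l => l
  | .semiBandit, v, l => fun i => if v i then l i else 0
  | .bandit, v, l => loss l v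

/-- A randomized forecaster strategy with action set `S` in the game `g`: in each round it draws
its action from a distribution on `S` that depends on its past actions and past observations.
Histories are listed with the most recent round first; the length of the list is the number of
completed rounds. -/
abbrev Forecaster {d : ℕ} (g : Game) (S : Finset (Action d)) : Type :=
  List (S × g.Obs d) → PMF S

/-- An adversary strategy: in each round it selects a loss vector, possibly depending on the past
actions of the forecaster (most recent first), and not on the current action. -/
abbrev Adversary (d : ℕ) : Type := List (Action d) → (Fin d → ℝ)

/-- Oblivious adversaries: the loss vector of a round depends on the number of the round only, so
that the adversary is just a sequence of loss vectors. -/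
def obliviousAdversaries (d : ℕ) : Set (Adversary d) :=
  {a | ∀ h h' : List (Action d), h.length = h'.length → a h = a h'}

/-- `L₂` adversaries: all loss vectors are in `[0,∞)^d` and satisfy `ℓᵀ v ≤ 1` for every `v ∈ S`. -/
def L2Adversaries {d : ℕ} (S : Finset (Action d)) : Set (Adversary d) :=
  {a | ∀ h, (∀ i, 0 ≤ a h i) ∧ ∀ v ∈ S, loss (a h) v ≤ 1}

/-- The law of the first `t` rounds: the list of the pairs (action, loss vector), most recent
round first, when the forecaster `F` plays against the adversary `a`. -/
def playLaw {d : ℕ} {g : Game} {S : Finset (Action d)} (F : Forecaster g S) (a : Adversary d) :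
    ℕ → PMF (List (S × (Fin d → ℝ)))
  | 0 => PMF.pure []
  | t + 1 => (playLaw F a t).bind fun h =>
      (F (h.map fun p => (p.1, g.observe p.1 p.2))).map fun v =>
        (v, a (h.map fun p => (p.1 : Action d))) :: h

/-- Expectation under a discrete distribution (used for laws of finite support only). -/
def expect {α : Type} (P : PMF α) (f : α → ℝ) : ℝ := ∑' x, (P x).toReal * f x

/-- The regret `E ∑ₜ ℓₜᵀ Vₜ - min_{v ∈ S} E ∑ₜ ℓₜᵀ v` after `n` rounds. -/
def regret {d : ℕ} {g : Game} {S : Finset (Action d)} (hS : S.Nonempty)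
    (F : Forecaster g S) (a : Adversary d) (n : ℕ) : ℝ :=
  expect (playLaw F a n) (fun h => (h.map fun p => loss p.2 p.1).sum) -
    S.inf' hS fun v => expect (playLaw F a n) (fun h => (h.map fun p => loss p.2 v).sum)

/-- The maximal minimax regret against the `L₂` adversaries in the class `A`: the maximum over the
nonempty action sets `S ⊆ {0,1}^d` of the infimum over the forecasters of the supremum over the
adversaries of the regret. It is taken in the extended reals, so that it needs no boundedness. -/
def maximalMinimaxRegret (g : Game) (d n : ℕ) (A : Set (Adversary d)) : EReal :=
  ⨆ (S : Finset (Action d)) (hS : S.Nonempty), ⨅ F : Forecaster g S,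
    ⨆ a ∈ A ∩ L2Adversaries S, ((regret hS F a n : ℝ) : EReal)

end CombGame

end

/-!
A single action set serves all three games. Put `k = d / 2`, group the coordinates into `k` pairs
and let the actions be the vectors that contain exactly one coordinate of each pair, so that an
action is a choice `x ∈ {0,1}^k`. The environment draws a pair uniformly and charges one unit to one
of its two coordinates: in the pair `i`, the side `σ i` is charged with probability `1 / 2 - ε`.
Every loss is `0` or `1`, so these are `L₂` losses. A bound on the regret against every fixed
sequence of loss vectors is a bound on its average over independent draws (`average_regret_le`), so
it suffices to bound from below the mean loss of the forecaster minus the mean of the smallest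
cumulative loss.

For `ε = 0` every strategy suffers a mean loss of `1 / 2` per round, whatever it is shown. The best
action gains half of the absolute imbalance between the two sides in each pair; the imbalance has
second moment `n / k` and fourth moment at most `4 (n / k)²`, hence first absolute moment at least
`√(n / k) / 2`. Summed over the pairs this is of the order of `√(k n)` (`unbiased_lower_bound`).

In the bandit game take `ε` of the order of `min 1 (k / √n)`. Given the action, the observation is a
Bernoulli variable, with parameter `1 / 2 - ε + (2 ε / k) · #{i | x i ≠ σ i}`. Reversing one entry of
`σ` moves this parameter by only `2 ε / k`, so that the Hellinger affinity of the two laws of an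
observation is at least `1 - (5 / 2) (ε / k)²`. Affinities multiply along the rounds
(`pow_le_sum_sqrt_chainWeight`), so after `t < n` rounds the two laws are still close and no rule can
tell them apart reliably (`le_sum_errors`). Averaged over `σ`, the forecaster is therefore wrong in a
constant fraction of its choices, and each wrong choice costs `2 ε / k` (`sum_errorProb_le`), which
gives a regret of the order of `ε n` (`bandit_lower_bound`). The constant `0.05` is reached, also for
`d = 3` where `k = d / 3`, because the error bounds are added up over the rounds as functions of `t`
instead of being replaced by the weakest one, that of the last round.

All laws are finite: the law of a play against a fixed sequence is rewritten as a sum over the lists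
of a fixed length, weighted by `chainWeight`.
-/

noncomputable section

namespace CombGame

open Finset

/-! ### Sums over lists of a fixed length -/

/-- The finite set of the lists of length `t` over a finite alphabet. -/
def listsOfLength (α : Type*) [Fintype α] : ℕ → Finset (List α)
  | 0 => {[]}
  | t + 1 => (listsOfLength α t ×ˢ (univ : Finset α)).map
      ⟨fun p => p.2 :: p.1, fun p q h => by
        obtain ⟨h1, h2⟩ := List.cons.inj h
        exact Prod.ext h2 h1⟩

/-- The weight of a list, most recent letter first, in the process in which the next letter after
the past `h` is `a` with weight `κ h a`. -/
def chainWeight {α : Type*} (κ : List α → α → ℝ) : List α → ℝ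
  | [] => 1
  | a :: h => chainWeight κ h * κ h a

lemma chainWeight_nonneg {α : Type*} {κ : List α → α → ℝ} (hκ : ∀ h a, 0 ≤ κ h a) (l : List α) :
    0 ≤ chainWeight κ l := by
  induction l with
  | nil => simp [chainWeight]
  | cons a h ih => exact mul_nonneg ih (hκ h a)

section Chains

variable {α β : Type*} [Fintype α] [Fintype β]

lemma sum_listsOfLength_zero (f : List α → ℝ) : ∑ l ∈ listsOfLength α 0, f l = f [] := by
  simp [listsOfLength]

lemma sum_listsOfLength_succ (t : ℕ) (f : List α → ℝ) :
    ∑ l ∈ listsOfLength α (t + 1), f l = ∑ h ∈ listsOfLength α t, ∑ a, f (a :: h) := by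
  rw [listsOfLength, sum_map, sum_product]
  rfl

lemma mem_listsOfLength {t : ℕ} {l : List α} : l ∈ listsOfLength α t ↔ l.length = t := by
  induction t generalizing l with
  | zero => simp [listsOfLength]
  | succ t ih =>
    cases l with
    | nil => simp [listsOfLength]
    | cons a l =>
      rw [listsOfLength, mem_map, List.length_cons, Nat.succ_inj, ← ih]
      constructor
      · rintro ⟨p, hp, h⟩
        obtain ⟨-, rfl⟩ := List.cons.inj h
        exact (mem_product.1 hp).1
      · exact fun h => ⟨(l, a), mem_product.2 ⟨h, mem_univ a⟩, rfl⟩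

lemma sum_chainWeight {κ : List α → α → ℝ} (hκ : ∀ h, ∑ a, κ h a = 1) (t : ℕ) :
    ∑ l ∈ listsOfLength α t, chainWeight κ l = 1 := by
  induction t with
  | zero => simp [sum_listsOfLength_zero, chainWeight]
  | succ t ih => simp [sum_listsOfLength_succ, chainWeight, ← mul_sum, hκ, ih]

lemma sum_chainWeight_mul_sum {κ : List α → α → ℝ} (hκ : ∀ h, ∑ a, κ h a = 1) (φ : α → ℝ)
    (n : ℕ) :
    ∑ l ∈ listsOfLength α n, chainWeight κ l * (l.map φ).sum =
      ∑ t ∈ range n, ∑ h ∈ listsOfLength α t, chainWeight κ h * ∑ a, κ h a * φ a := by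
  induction n with
  | zero => simp [sum_listsOfLength_zero]
  | succ n ih =>
    rw [sum_range_succ, ← ih, sum_listsOfLength_succ, ← sum_add_distrib]
    refine sum_congr rfl fun h _ => ?_
    have : ∀ a, chainWeight κ (a :: h) * (((a :: h).map φ).sum) =
        chainWeight κ h * (κ h a * φ a) + (chainWeight κ h * (h.map φ).sum) * κ h a := by
      intro a
      simp only [chainWeight, List.map_cons, List.sum_cons]
      ring
    rw [sum_congr rfl fun a _ => this a, sum_add_distrib, ← mul_sum, ← mul_sum, hκ, mul_one,
      add_comm]

/-- If the letterwise image under `π` is again such a process, expectations of functions of the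
image can be computed with its own weights. -/
lemma sum_chainWeight_map [DecidableEq β] {κ : List α → α → ℝ} {κ' : List β → β → ℝ}
    (π : α → β)
    (h : ∀ l b, (∑ a with π a = b, κ l a) = κ' (l.map π) b) (t : ℕ) (f : List β → ℝ) :
    ∑ l ∈ listsOfLength α t, chainWeight κ l * f (l.map π) =
      ∑ l ∈ listsOfLength β t, chainWeight κ' l * f l := by
  induction t generalizing f with
  | zero => simp [sum_listsOfLength_zero, chainWeight]
  | succ t ih =>
    rw [sum_listsOfLength_succ, sum_listsOfLength_succ]
    simp only [chainWeight, List.map_cons, mul_assoc, ← mul_sum]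
    rw [← ih fun l => ∑ b, κ' l b * f (b :: l)]
    refine sum_congr rfl fun l _ => ?_
    congr 1
    rw [← sum_fiberwise univ π]
    refine sum_congr rfl fun b _ => ?_
    rw [← h, sum_mul]
    refine sum_congr rfl fun a ha => ?_
    rw [(mem_filter.1 ha).2]

/-- Hellinger affinities multiply along a process. -/
lemma pow_le_sum_sqrt_chainWeight {κ κ' : List α → α → ℝ} (hκ : ∀ h a, 0 ≤ κ h a)
    (hκ' : ∀ h a, 0 ≤ κ' h a) {ρ : ℝ} (hρ : 0 ≤ ρ)
    (h : ∀ l, ρ ≤ ∑ a, √(κ l a * κ' l a)) (t : ℕ) :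
    ρ ^ t ≤ ∑ l ∈ listsOfLength α t, √(chainWeight κ l * chainWeight κ' l) := by
  induction t with
  | zero => simp [sum_listsOfLength_zero, chainWeight]
  | succ t ih =>
    rw [sum_listsOfLength_succ, pow_succ]
    calc ρ ^ t * ρ
        ≤ (∑ l ∈ listsOfLength α t, √(chainWeight κ l * chainWeight κ' l)) * ρ := by gcongr
      _ ≤ _ := by
        rw [sum_mul]
        refine sum_le_sum fun l _ => ?_
        have : ∀ a, √(chainWeight κ (a :: l) * chainWeight κ' (a :: l)) =
            √(chainWeight κ l * chainWeight κ' l) * √(κ l a * κ' l a) := by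
          intro a
          rw [← Real.sqrt_mul (mul_nonneg (chainWeight_nonneg hκ l) (chainWeight_nonneg hκ' l))]
          simp only [chainWeight]
          ring_nf
        rw [sum_congr rfl fun a _ => this a, ← mul_sum]
        exact mul_le_mul_of_nonneg_left (h l) (Real.sqrt_nonneg _)

/-- The minimum of two weights in terms of their geometric mean; for `x, y ≥ 0` the difference
`min (x²) (y²) - 15/8 x y + 9/16 (x² + y²)` is a perfect square. -/
lemma sqrt_mul_le_convex_comb {w w' c : ℝ} (hw : 0 ≤ w) (hw' : 0 ≤ w') (hc : 0 ≤ c)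
    (hc1 : c ≤ 1) :
    15 / 8 * √(w * w') - 9 / 16 * (w + w') ≤ w * c + w' * (1 - c) := by
  rw [Real.sqrt_mul hw]
  have h1 := Real.sq_sqrt hw
  have h2 := Real.sq_sqrt hw'
  rcases le_total w w' with h | h
  · nlinarith [sq_nonneg (5 * √w - 3 * √w'), mul_nonneg (sub_nonneg.2 h) (sub_nonneg.2 hc1)]
  · nlinarith [sq_nonneg (5 * √w' - 3 * √w), mul_nonneg (sub_nonneg.2 h) hc]

/-- The two error probabilities of a test `φ` between two processes add up to almost `3/4` as
long as the one-step affinities are close to `1`. -/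
lemma le_sum_errors {κ κ' : List α → α → ℝ} (hκ : ∀ h a, 0 ≤ κ h a)
    (hκ' : ∀ h a, 0 ≤ κ' h a) (hκ1 : ∀ h, ∑ a, κ h a = 1) (hκ1' : ∀ h, ∑ a, κ' h a = 1)
    {η : ℝ} (hη : η ≤ 1) (h : ∀ l, 1 - η ≤ ∑ a, √(κ l a * κ' l a))
    {φ : List α → ℝ} (hφ : ∀ l, 0 ≤ φ l) (hφ1 : ∀ l, φ l ≤ 1) (t : ℕ) :
    3 / 4 - 15 / 8 * (t * η) ≤ ∑ l ∈ listsOfLength α t, chainWeight κ l * φ l +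
      ∑ l ∈ listsOfLength α t, chainWeight κ' l * (1 - φ l) := by
  have hpow : 1 - t * η ≤ (1 - η) ^ t := by
    have := one_add_mul_le_pow (a := -η) (by linarith) t
    rw [← sub_eq_add_neg] at this
    linarith
  have haff := hpow.trans (pow_le_sum_sqrt_chainWeight hκ hκ' (sub_nonneg.2 hη) h t)
  rw [← sum_add_distrib]
  have key := sum_le_sum fun l (_ : l ∈ listsOfLength α t) =>
    sqrt_mul_le_convex_comb (chainWeight_nonneg hκ l) (chainWeight_nonneg hκ' l) (hφ l) (hφ1 l)
  rw [sum_sub_distrib, ← mul_sum, ← mul_sum, sum_add_distrib, sum_chainWeight hκ1,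
    sum_chainWeight hκ1'] at key
  linarith

end Chains

/-- The affinity of two Bernoulli laws with parameters in `[2/5, 3/5]`. -/
lemma le_bernoulli_affinity {p q : ℝ} (hp : 2 / 5 ≤ p) (hp' : p ≤ 3 / 5) (hq : 2 / 5 ≤ q)
    (hq' : q ≤ 3 / 5) :
    1 - 5 / 8 * (p - q) ^ 2 ≤ √(p * q) + √((1 - p) * (1 - q)) := by
  have key : ∀ {x y : ℝ}, 2 / 5 ≤ x → 2 / 5 ≤ y →
      (x + y) / 2 - 5 / 16 * (x - y) ^ 2 ≤ √(x * y) := by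
    intro x y hx hy
    have hx0 : 0 ≤ x := by linarith
    have hy0 : 0 ≤ y := by linarith
    rw [Real.sqrt_mul hx0]
    have hx2 := Real.sq_sqrt hx0
    have hy2 := Real.sq_sqrt hy0
    have hx1 := Real.sqrt_nonneg x
    have hy1 := Real.sqrt_nonneg y
    have hxy : 2 / 5 ≤ √x * √y := by
      rw [← Real.sqrt_mul hx0]
      exact Real.le_sqrt_of_sq_le (by nlinarith)
    have hsum : 8 / 5 ≤ (√x + √y) ^ 2 := by nlinarith
    have hfac : (x - y) ^ 2 = (√x - √y) ^ 2 * (√x + √y) ^ 2 := by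
      rw [← mul_pow, ← hx2, ← hy2]
      simp only [Real.sqrt_sq hx1, Real.sqrt_sq hy1]
      ring
    have := mul_le_mul_of_nonneg_left hsum (sq_nonneg (√x - √y))
    rw [hfac]
    nlinarith
  have h1 := key hp hq
  have h2 := key (x := 1 - p) (y := 1 - q) (by linarith) (by linarith)
  have h3 : (1 - p - (1 - q)) ^ 2 = (p - q) ^ 2 := by ring
  rw [h3] at h2
  linarith

/-! ### Expectations under the law of a play -/

lemma expect_eq_sum {α : Type} (P : PMF α) (f : α → ℝ) {s : Finset α}
    (hs : ∀ x ∉ s, P x = 0) : expect P f = ∑ x ∈ s, (P x).toReal * f x :=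
  tsum_eq_sum fun x hx => by simp [hs x hx]

lemma expect_const {α : Type} (P : PMF α) (c : ℝ) : expect P (fun _ => c) = c := by
  rw [expect, tsum_mul_right, ← ENNReal.tsum_toReal_eq fun x => P.apply_ne_top x, P.tsum_coe]
  simp

lemma expect_pure {α : Type} (x : α) (f : α → ℝ) : expect (PMF.pure x) f = f x := by
  classical
  rw [expect_eq_sum (PMF.pure x) f (s := {x})]
  · simp
  · intro y hy
    simpa using hy

lemma expect_map {α β : Type} [Fintype α] (P : PMF α) (u : α → β) (f : β → ℝ) :
    expect (P.map u) f = ∑ x, (P x).toReal * f (u x) := by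
  classical
  rw [expect_eq_sum (P.map u) f (s := univ.image u)]
  · have : ∀ y, ((P.map u) y).toReal = ∑ x with u x = y, (P x).toReal := by
      intro y
      rw [PMF.map_apply, tsum_fintype, ENNReal.toReal_sum, sum_filter]
      · refine sum_congr rfl fun x _ => ?_
        by_cases h : y = u x
        · simp [h]
        · simp [h, Ne.symm h]
      · intro x _
        split_ifs
        · exact P.apply_ne_top x
        · exact ENNReal.zero_ne_top
    rw [← sum_fiberwise_of_maps_to (t := univ.image u) (g := u)
      (fun x _ => mem_image_of_mem u (mem_univ x))]
    refine sum_congr rfl fun y _ => ?_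
    rw [this, sum_mul]
    refine sum_congr rfl fun x hx => ?_
    rw [(mem_filter.1 hx).2]
  · intro y hy
    rw [PMF.apply_eq_zero_iff]
    intro hy'
    rw [PMF.mem_support_map_iff] at hy'
    obtain ⟨x, -, rfl⟩ := hy'
    exact hy (mem_image_of_mem u (mem_univ x))

lemma expect_bind {α β : Type} (P : PMF α) (q : α → PMF β) (f : β → ℝ)
    (hP : P.support.Finite) (hq : ∀ x, (q x).support.Finite) :
    expect (P.bind q) f = expect P fun x => expect (q x) f := by
  have hs : ∀ x ∉ hP.toFinset, P x = 0 := fun x hx => by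
    rwa [Set.Finite.mem_toFinset, PMF.mem_support_iff, not_not] at hx
  rw [expect_eq_sum P _ hs]
  have h1 : ∀ y, ((P.bind q) y).toReal * f y =
      ∑ x ∈ hP.toFinset, (P x).toReal * ((q x y).toReal * f y) := by
    intro y
    rw [PMF.bind_apply, tsum_eq_sum (s := hP.toFinset) fun x hx => by simp [hs x hx],
      ENNReal.toReal_sum, sum_mul]
    · refine sum_congr rfl fun x _ => ?_
      rw [ENNReal.toReal_mul, mul_assoc]
    · intro x _
      exact ENNReal.mul_ne_top (P.apply_ne_top x) ((q x).apply_ne_top y)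
  simp only [expect]
  rw [tsum_congr h1, Summable.tsum_finsetSum]
  · exact sum_congr rfl fun x _ => tsum_mul_left
  · intro x _
    refine Summable.mul_left _ (summable_of_ne_finset_zero (s := (hq x).toFinset) fun y hy => ?_)
    have : q x y = 0 := by rwa [Set.Finite.mem_toFinset, PMF.mem_support_iff, not_not] at hy
    simp [this]

lemma sum_toReal_apply {α : Type*} [Fintype α] (P : PMF α) : ∑ x, (P x).toReal = 1 := by
  rw [← ENNReal.toReal_sum fun x _ => P.apply_ne_top x,
    ← tsum_fintype (L := .unconditional _), P.tsum_coe]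
  simp

section Play

variable {d : ℕ} {g : Game} {S : Finset (Action d)}

lemma finite_support_playLaw (F : Forecaster g S) (a : Adversary d) (t : ℕ) :
    (playLaw F a t).support.Finite := by
  induction t with
  | zero => simp [playLaw]
  | succ t ih =>
    rw [playLaw, PMF.support_bind]
    refine ih.biUnion fun h _ => ?_
    rw [PMF.support_map]
    exact (Set.toFinite _).image _

lemma expect_playLaw_succ (F : Forecaster g S) (a : Adversary d) (t : ℕ)
    (f : List (S × (Fin d → ℝ)) → ℝ) :
    expect (playLaw F a (t + 1)) f = expect (playLaw F a t) fun h =>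
      ∑ v, (F (h.map fun p => (p.1, g.observe p.1 p.2)) v).toReal *
        f ((v, a (h.map fun p => (p.1 : Action d))) :: h) := by
  rw [playLaw, expect_bind _ _ _ (finite_support_playLaw F a t)]
  · simp only [expect_map]
  · intro h
    rw [PMF.support_map]
    exact (Set.toFinite _).image _

/-! ### Averaging over oblivious adversaries -/

variable {Ω : Type}

/-- The first `t` terms of a sequence, most recent first. -/
def pastOf (ω : ℕ → Ω) : ℕ → List Ω
  | 0 => []
  | t + 1 => ω t :: pastOf ω t

lemma pastOf_congr {ω ω' : ℕ → Ω} {t : ℕ} (h : ∀ s < t, ω s = ω' s) :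
    pastOf ω t = pastOf ω' t := by
  induction t with
  | zero => rfl
  | succ t ih =>
    rw [pastOf, pastOf, h t t.lt_succ_self, ih fun s hs => h s (hs.trans t.lt_succ_self)]

lemma exists_pastOf_eq [Nonempty Ω] (l : List Ω) : ∃ ω : ℕ → Ω, pastOf ω l.length = l := by
  induction l with
  | nil => exact ⟨fun _ => Classical.arbitrary Ω, rfl⟩
  | cons o l ih =>
    obtain ⟨ω, hω⟩ := ih
    refine ⟨Function.update ω l.length o, ?_⟩
    rw [List.length_cons, pastOf, Function.update_self]
    congr 1
    conv_rhs => rw [← hω]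
    exact pastOf_congr fun s hs => Function.update_of_ne hs.ne _ _

/-- The oblivious adversary that plays the loss vectors `L (ω 0), L (ω 1), …`. -/
def sequenceAdversary (L : Ω → Fin d → ℝ) (ω : ℕ → Ω) : Adversary d := fun h => L (ω h.length)

/-- What the forecaster has seen after the actions and environment outcomes `z`, when the outcome
`o` gives the loss vector `L o`. -/
def seen (g : Game) (L : Ω → Fin d → ℝ) (z : List (S × Ω)) : List (S × g.Obs d) :=
  z.map fun p => (p.1, g.observe p.1 (L p.2))

/-- The probability of the next action of the forecaster, given actions and outcomes so far. -/
def actionKernel (F : Forecaster g S) (L : Ω → Fin d → ℝ) (z : List (S × Ω)) (p : S × Ω) : ℝ :=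
  (F (seen g L z) p.1).toReal

/-- The joint law of action and outcome in the next round when the outcomes are independent with
law `P`. -/
def jointKernel (F : Forecaster g S) (L : Ω → Fin d → ℝ) (P : Ω → ℝ) (z : List (S × Ω))
    (p : S × Ω) : ℝ :=
  (F (seen g L z) p.1).toReal * P p.2

lemma chainWeight_jointKernel (F : Forecaster g S) (L : Ω → Fin d → ℝ) (P : Ω → ℝ)
    (z : List (S × Ω)) :
    chainWeight (jointKernel F L P) z =
      chainWeight (actionKernel F L) z * chainWeight (fun _ => P) (z.map Prod.snd) := by
  induction z with
  | nil => simp [chainWeight]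
  | cons p z ih =>
    simp only [chainWeight, ih, List.map_cons, jointKernel, actionKernel]
    ring

variable [Fintype Ω]

/-- Against a fixed sequence only the histories with the outcomes of that sequence have positive
probability. -/
lemma expect_playLaw_sequenceAdversary [DecidableEq Ω] (F : Forecaster g S) (L : Ω → Fin d → ℝ)
    (ω : ℕ → Ω) (t : ℕ) (f : List (S × (Fin d → ℝ)) → ℝ) :
    expect (playLaw F (sequenceAdversary L ω) t) f =
      ∑ z ∈ listsOfLength (S × Ω) t,
        if z.map Prod.snd = pastOf ω t then
          chainWeight (actionKernel F L) z * f (z.map fun p => (p.1, L p.2)) else 0 := by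
  induction t generalizing f with
  | zero =>
    rw [sum_listsOfLength_zero]
    simp [playLaw, expect_pure, pastOf, chainWeight]
  | succ t ih =>
    rw [expect_playLaw_succ, ih, sum_listsOfLength_succ]
    refine sum_congr rfl fun z hz => ?_
    have hlen : z.length = t := mem_listsOfLength.1 hz
    rw [Fintype.sum_prod_type]
    by_cases h : z.map Prod.snd = pastOf ω t
    · rw [if_pos h, mul_sum]
      refine sum_congr rfl fun v _ => ?_
      rw [sum_eq_single (ω t)]
      · simp only [List.map_cons, h, pastOf, if_true, chainWeight, actionKernel, seen,
          sequenceAdversary, List.map_map, List.length_map, hlen, mul_assoc]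
        rfl
      · intro o _ ho
        simp [pastOf, ho]
      · simp
    · simp [h, pastOf]

lemma sum_jointKernel (F : Forecaster g S) (L : Ω → Fin d → ℝ) {P : Ω → ℝ}
    (hP : ∑ o, P o = 1) (z : List (S × Ω)) : ∑ p, jointKernel F L P z p = 1 := by
  simp only [Fintype.sum_prod_type, jointKernel, ← mul_sum, hP, mul_one, sum_toReal_apply]

/-- A bound on the regret against all oblivious adversaries bounds the regret averaged over
independent random outcomes. -/
theorem average_regret_le [DecidableEq Ω] [Nonempty Ω] (hS : S.Nonempty) (F : Forecaster g S)
    {L : Ω → Fin d → ℝ} (hL : ∀ o i, 0 ≤ L o i) (hL1 : ∀ o, ∀ v ∈ S, loss (L o) v ≤ 1)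
    {P : Ω → ℝ} (hP : ∀ o, 0 ≤ P o) (hP1 : ∑ o, P o = 1) (n : ℕ) {M : ℝ}
    (hM : ∀ a ∈ obliviousAdversaries d ∩ L2Adversaries S, regret hS F a n ≤ M) :
    ∑ z ∈ listsOfLength (S × Ω) n,
        chainWeight (jointKernel F L P) z * (z.map fun p => loss (L p.2) p.1).sum -
      ∑ l ∈ listsOfLength Ω n, chainWeight (fun _ => P) l *
        S.inf' hS (fun v => (l.map fun o => loss (L o) v).sum) ≤ M := by
  have hreg : ∀ l ∈ listsOfLength Ω n,
      (∑ z ∈ listsOfLength (S × Ω) n, if z.map Prod.snd = l then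
        chainWeight (actionKernel F L) z * (z.map fun p => loss (L p.2) p.1).sum else 0) -
      S.inf' hS (fun v => (l.map fun o => loss (L o) v).sum) ≤ M := by
    intro l hl
    obtain ⟨ω, hω⟩ := exists_pastOf_eq l
    rw [mem_listsOfLength.1 hl] at hω
    have ha : sequenceAdversary L ω ∈ obliviousAdversaries d ∩ L2Adversaries S :=
      ⟨fun h h' hh => by simp [sequenceAdversary, hh], fun h => ⟨hL _, hL1 _⟩⟩
    refine le_trans (le_of_eq ?_) (hM _ ha)
    unfold regret
    congr 1
    · rw [expect_playLaw_sequenceAdversary, hω]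
      simp only [List.map_map]
      rfl
    · congr 1
      funext v
      rw [← expect_const (playLaw F (sequenceAdversary L ω) n)
          ((l.map fun o => loss (L o) v).sum),
        expect_playLaw_sequenceAdversary, expect_playLaw_sequenceAdversary, hω]
      refine sum_congr rfl fun z _ => ?_
      split_ifs with h
      · rw [← h, List.map_map, List.map_map]
        rfl
      · rfl
  have hw : ∀ l : List Ω, 0 ≤ chainWeight (fun _ => P) l := chainWeight_nonneg fun _ => hP
  have key := sum_le_sum fun l hl => mul_le_mul_of_nonneg_left (hreg l hl) (hw l)
  rw [← sum_mul, sum_chainWeight (fun _ => hP1), one_mul] at key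
  refine le_trans (le_of_eq ?_) key
  simp only [mul_sub, sum_sub_distrib]
  congr 1
  simp only [mul_sum]
  rw [sum_comm]
  refine sum_congr rfl fun z hz => ?_
  rw [sum_eq_single (z.map Prod.snd)]
  · rw [if_pos rfl, chainWeight_jointKernel]
    ring
  · intro l _ hl
    rw [if_neg hl.symm, mul_zero]
  · intro h
    exact absurd (mem_listsOfLength.2 (by rw [List.length_map, mem_listsOfLength.1 hz])) h

theorem le_maximalMinimaxRegret {n : ℕ} {A : Set (Adversary d)}
    (hA : obliviousAdversaries d ⊆ A) (hS : S.Nonempty) {c : ℝ}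
    (h : ∀ (F : Forecaster g S) (M : ℝ),
      (∀ a ∈ obliviousAdversaries d ∩ L2Adversaries S, regret hS F a n ≤ M) → c ≤ M) :
    (c : EReal) ≤ maximalMinimaxRegret g d n A := by
  refine le_iSup₂_of_le S hS (le_iInf fun F => ?_)
  by_contra! hlt
  obtain ⟨M, hM1, hM2⟩ := EReal.lt_iff_exists_real_btwn.1 hlt
  refine absurd (h F M fun a ha => ?_) (not_le.2 (EReal.coe_lt_coe_iff.1 hM2))
  rw [← EReal.coe_le_coe_iff]
  exact (le_iSup₂ (f := fun a (_ : a ∈ A ∩ L2Adversaries S) => ((regret hS F a n : ℝ) : EReal)) a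
    ⟨hA ha.1, ha.2⟩).trans hM1.le

end Play

/-! ### The paired action set and its random environment -/

variable {d : ℕ}

/-- The two coordinates that form the `i`-th pair; the last coordinate stays unpaired when `d` is
odd. -/
def coord (i : Fin (d / 2)) (b : Bool) : Fin d :=
  ⟨2 * i + if b then 1 else 0, by have := i.2; split_ifs <;> omega⟩

/-- The actions that contain exactly one coordinate of each pair. -/
def pairedActions (d : ℕ) : Finset (Action d) :=
  univ.filter fun v => ∀ i : Fin (d / 2), v (coord i false) = !v (coord i true)

/-- The loss vector that charges one unit to the coordinate `b` of the pair `i`. -/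
def unitLoss (o : Fin (d / 2) × Bool) : Fin d → ℝ := Pi.single (coord o.1 o.2) 1

/-- The choice that an action makes in the `i`-th pair. -/
def choice (v : Action d) (i : Fin (d / 2)) : Bool := v (coord i true)

lemma apply_coord {v : Action d} (hv : v ∈ pairedActions d) (i : Fin (d / 2)) (b : Bool) :
    v (coord i b) = decide (choice v i = b) := by
  have h := (mem_filter.1 hv).2 i
  cases b
  · rw [h, choice]
    cases v (coord i true) <;> rfl
  · rw [choice]
    cases v (coord i true) <;> rfl

lemma exists_choice_eq (σ : Fin (d / 2) → Bool) : ∃ v ∈ pairedActions d, choice v = σ := by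
  let v : Action d := fun j =>
    if h : (j : ℕ) / 2 < d / 2 then (if (j : ℕ) % 2 = 1 then σ ⟨j / 2, h⟩ else !σ ⟨j / 2, h⟩)
    else false
  have h1 : ∀ i, v (coord i true) = σ i := by
    intro i
    have e : (2 * (i : ℕ) + 1) / 2 = i := by omega
    have e' : (2 * (i : ℕ) + 1) % 2 = 1 := by omega
    simp [v, coord, e, e']
  have h2 : ∀ i, v (coord i false) = !σ i := by
    intro i
    simp [v, coord]
  exact ⟨v, mem_filter.2 ⟨mem_univ _, fun i => by rw [h1, h2]⟩, funext h1⟩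

lemma pairedActions_nonempty (d : ℕ) : (pairedActions d).Nonempty :=
  let ⟨v, hv, _⟩ := exists_choice_eq (d := d) fun _ => true
  ⟨v, hv⟩

lemma loss_unitLoss (o : Fin (d / 2) × Bool) (v : Action d) :
    loss (unitLoss o) v = if v (coord o.1 o.2) then 1 else 0 := by
  rw [loss, sum_eq_single (coord o.1 o.2)]
  · simp [unitLoss]
  · intro j _ hj
    simp [unitLoss, hj]
  · simp

lemma loss_unitLoss_of_mem {v : Action d} (hv : v ∈ pairedActions d) (o : Fin (d / 2) × Bool) :
    loss (unitLoss o) v = if choice v o.1 = o.2 then 1 else 0 := by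
  simp [loss_unitLoss, apply_coord hv]

lemma unitLoss_nonneg (o : Fin (d / 2) × Bool) (i : Fin d) : 0 ≤ unitLoss o i := by
  unfold unitLoss
  rcases eq_or_ne i (coord o.1 o.2) with rfl | h
  · simp
  · simp [h]

lemma loss_unitLoss_le_one (o : Fin (d / 2) × Bool) (v : Action d) :
    loss (unitLoss o) v ≤ 1 := by
  rw [loss_unitLoss]
  split_ifs <;> norm_num

/-- The law of the charged coordinate: the pair is uniform, and within the pair `i` the side `σ i`
is charged with probability `1 / 2 - ε`. -/
def biasedLaw (ε : ℝ) (σ : Fin (d / 2) → Bool) (o : Fin (d / 2) × Bool) : ℝ :=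
  (1 / 2 + if o.2 = σ o.1 then -ε else ε) / (d / 2 : ℕ)

lemma biasedLaw_nonneg {ε : ℝ} (h0 : 0 ≤ ε) (h1 : ε ≤ 1 / 10) (σ : Fin (d / 2) → Bool)
    (o : Fin (d / 2) × Bool) : 0 ≤ biasedLaw ε σ o := by
  unfold biasedLaw
  have : 0 ≤ 1 / 2 + if o.2 = σ o.1 then -ε else ε := by split_ifs <;> linarith
  positivity

lemma sum_biasedLaw_side (ε : ℝ) (σ : Fin (d / 2) → Bool) (i : Fin (d / 2)) :
    ∑ b, biasedLaw ε σ (i, b) = 1 / (d / 2 : ℕ) := by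
  rw [Fintype.sum_bool]
  simp only [biasedLaw]
  cases σ i <;> simp <;> ring

lemma sum_biasedLaw (hd : 2 ≤ d) (ε : ℝ) (σ : Fin (d / 2) → Bool) :
    ∑ o, biasedLaw ε σ o = 1 := by
  have : ((d / 2 : ℕ) : ℝ) ≠ 0 := by
    have : 0 < d / 2 := by omega
    positivity
  simp only [Fintype.sum_prod_type, sum_biasedLaw_side]
  simp [this]

/-- The expected loss of an action under `biasedLaw ε σ`. -/
def meanLoss (ε : ℝ) (σ : Fin (d / 2) → Bool) (v : Action d) : ℝ :=
  ∑ o, biasedLaw ε σ o * loss (unitLoss o) v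

lemma meanLoss_eq (hd : 2 ≤ d) (ε : ℝ) (σ : Fin (d / 2) → Bool) {v : Action d}
    (hv : v ∈ pairedActions d) :
    meanLoss ε σ v =
      1 / 2 - ε + 2 * ε / (d / 2 : ℕ) * ∑ i, if choice v i = σ i then 0 else 1 := by
  have hk : ((d / 2 : ℕ) : ℝ) ≠ 0 := by
    have : 0 < d / 2 := by omega
    positivity
  have h : ∀ i, ∑ b, biasedLaw ε σ (i, b) * loss (unitLoss (i, b)) v =
      (1 / 2 - ε) / (d / 2 : ℕ) +
        2 * ε / (d / 2 : ℕ) * if choice v i = σ i then 0 else 1 := by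
    intro i
    simp only [loss_unitLoss_of_mem hv, biasedLaw, Fintype.sum_bool]
    cases choice v i <;> cases σ i <;> simp <;> ring
  rw [meanLoss, Fintype.sum_prod_type, sum_congr rfl fun i _ => h i, sum_add_distrib, ← mul_sum]
  simp
  field_simp

/-- The expected cumulative loss of a forecaster is the sum of the mean losses of its actions,
because an action is independent of the outcome of its own round. -/
lemma sum_joint_loss (hd : 2 ≤ d) {g : Game} (F : Forecaster g (pairedActions d)) (ε : ℝ)
    (σ : Fin (d / 2) → Bool) (n : ℕ) :
    ∑ z ∈ listsOfLength (pairedActions d × (Fin (d / 2) × Bool)) n,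
        chainWeight (jointKernel F unitLoss (biasedLaw ε σ)) z *
          (z.map fun p => loss (unitLoss p.2) p.1).sum =
      ∑ t ∈ range n, ∑ z ∈ listsOfLength (pairedActions d × (Fin (d / 2) × Bool)) t,
        chainWeight (jointKernel F unitLoss (biasedLaw ε σ)) z *
          ∑ v, (F (seen g unitLoss z) v).toReal * meanLoss ε σ v := by
  rw [sum_chainWeight_mul_sum (sum_jointKernel F unitLoss (sum_biasedLaw hd ε σ))
    fun p => loss (unitLoss p.2) p.1]
  refine sum_congr rfl fun t _ => sum_congr rfl fun z _ => ?_
  simp only [Fintype.sum_prod_type, jointKernel, meanLoss, mul_assoc, mul_sum]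

/-! ### The unbiased environment -/

/-- The sign that the outcome `o` contributes to the balance of the pair `i`. -/
def pairSign (i : Fin (d / 2)) (o : Fin (d / 2) × Bool) : ℝ :=
  if o.1 = i then (if o.2 then 1 else -1) else 0

/-- How much more often the side `true` of the pair `i` is charged than the side `false`. -/
def balance (i : Fin (d / 2)) (l : List (Fin (d / 2) × Bool)) : ℝ := (l.map (pairSign i)).sum

lemma sum_loss_eq_balance {v : Action d} (hv : v ∈ pairedActions d)
    (l : List (Fin (d / 2) × Bool)) :
    (l.map fun o => loss (unitLoss o) v).sum =
      l.length / 2 + 1 / 2 * ∑ i, (if choice v i then 1 else -1) * balance i l := by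
  induction l with
  | nil => simp [balance]
  | cons o l ih =>
    obtain ⟨j, b⟩ := o
    have h : ∑ i, (if choice v i then (1 : ℝ) else -1) * pairSign i (j, b) =
        (if choice v j then 1 else -1) * (if b then 1 else -1) := by
      simp [pairSign]
    simp only [balance] at ih
    rw [List.map_cons, List.sum_cons, ih, loss_unitLoss_of_mem hv]
    simp only [balance, List.map_cons, List.sum_cons, List.length_cons, mul_add,
      sum_add_distrib, h]
    push_cast
    cases choice v j <;> cases b <;> simp <;> ring

lemma inf'_le_balance (l : List (Fin (d / 2) × Bool)) :
    (pairedActions d).inf' (pairedActions_nonempty d)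
        (fun v => (l.map fun o => loss (unitLoss o) v).sum) ≤
      l.length / 2 - 1 / 2 * ∑ i, |balance i l| := by
  obtain ⟨v, hv, hσ⟩ := exists_choice_eq (d := d) fun i => decide (balance i l < 0)
  refine (inf'_le _ hv).trans (le_of_eq ?_)
  rw [sum_loss_eq_balance hv, sub_eq_add_neg, ← mul_neg, ← sum_neg_distrib]
  congr 2
  refine sum_congr rfl fun i _ => ?_
  rw [hσ]
  by_cases h : balance i l < 0
  · simp [h, abs_of_neg h]
  · simp [h, abs_of_nonneg (not_lt.1 h)]

/-- Expectation, under the unbiased law, of a function that vanishes outside the pair `i`. -/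
lemma sum_biasedLaw_zero_mul (σ : Fin (d / 2) → Bool) (i : Fin (d / 2))
    (f : Fin (d / 2) × Bool → ℝ) (c : ℝ) (hf : ∀ o, o.1 ≠ i → f o = 0)
    (hc : f (i, true) + f (i, false) = 2 * c) :
    ∑ o, biasedLaw 0 σ o * f o = c / (d / 2 : ℕ) := by
  rw [Fintype.sum_prod_type, sum_eq_single i]
  · rw [Fintype.sum_bool]
    simp only [biasedLaw, neg_zero, ite_self, add_zero]
    rw [← mul_add, hc]
    ring
  · intro j _ hj
    simp [hf (j, _) hj]
  · simp

lemma sum_balance_sq (hd : 2 ≤ d) (σ : Fin (d / 2) → Bool) (i : Fin (d / 2)) (n : ℕ) :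
    ∑ l ∈ listsOfLength (Fin (d / 2) × Bool) n,
      chainWeight (fun _ => biasedLaw 0 σ) l * balance i l ^ 2 = n / (d / 2 : ℕ) := by
  induction n with
  | zero => simp [sum_listsOfLength_zero, balance]
  | succ n ih =>
    have h : ∀ l : List (Fin (d / 2) × Bool),
        ∑ o, chainWeight (fun _ => biasedLaw 0 σ) (o :: l) * balance i (o :: l) ^ 2 =
          chainWeight (fun _ => biasedLaw 0 σ) l * balance i l ^ 2 +
            chainWeight (fun _ => biasedLaw 0 σ) l * (1 / (d / 2 : ℕ)) := by
      intro l
      have e : ∀ o, chainWeight (fun _ => biasedLaw 0 σ) (o :: l) * balance i (o :: l) ^ 2 =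
          chainWeight (fun _ => biasedLaw 0 σ) l * balance i l ^ 2 * biasedLaw 0 σ o +
          chainWeight (fun _ => biasedLaw 0 σ) l * (biasedLaw 0 σ o *
            (pairSign i o ^ 2 + 2 * pairSign i o * balance i l)) := by
        intro o
        simp only [chainWeight, balance, List.map_cons, List.sum_cons]
        ring
      rw [sum_congr rfl fun o _ => e o, sum_add_distrib, ← mul_sum, ← mul_sum,
        sum_biasedLaw hd, mul_one,
        sum_biasedLaw_zero_mul σ i _ 1 (fun o ho => by simp [pairSign, ho])
          (by simp [pairSign]; ring)]
    rw [sum_listsOfLength_succ, sum_congr rfl fun l _ => h l, sum_add_distrib, ih, ← sum_mul,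
      sum_chainWeight fun _ => sum_biasedLaw hd 0 σ]
    push_cast
    ring

lemma sum_balance_pow_four (hd : 2 ≤ d) (σ : Fin (d / 2) → Bool) (i : Fin (d / 2)) (n : ℕ) :
    ∑ l ∈ listsOfLength (Fin (d / 2) × Bool) n,
      chainWeight (fun _ => biasedLaw 0 σ) l * balance i l ^ 4 =
        n / (d / 2 : ℕ) + 3 * n * (n - 1) / (d / 2 : ℕ) ^ 2 := by
  induction n with
  | zero => simp [sum_listsOfLength_zero, balance]
  | succ n ih =>
    have h : ∀ l : List (Fin (d / 2) × Bool),
        ∑ o, chainWeight (fun _ => biasedLaw 0 σ) (o :: l) * balance i (o :: l) ^ 4 =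
          chainWeight (fun _ => biasedLaw 0 σ) l * balance i l ^ 4 +
            chainWeight (fun _ => biasedLaw 0 σ) l * (1 / (d / 2 : ℕ)) +
            chainWeight (fun _ => biasedLaw 0 σ) l * balance i l ^ 2 * (6 / (d / 2 : ℕ)) := by
      intro l
      have e : ∀ o, chainWeight (fun _ => biasedLaw 0 σ) (o :: l) * balance i (o :: l) ^ 4 =
          chainWeight (fun _ => biasedLaw 0 σ) l * balance i l ^ 4 * biasedLaw 0 σ o +
          chainWeight (fun _ => biasedLaw 0 σ) l * (biasedLaw 0 σ o *
            (pairSign i o ^ 4 + 4 * pairSign i o ^ 3 * balance i l +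
              6 * pairSign i o ^ 2 * balance i l ^ 2 + 4 * pairSign i o * balance i l ^ 3)) := by
        intro o
        simp only [chainWeight, balance, List.map_cons, List.sum_cons]
        ring
      rw [sum_congr rfl fun o _ => e o, sum_add_distrib, ← mul_sum, ← mul_sum,
        sum_biasedLaw hd, mul_one,
        sum_biasedLaw_zero_mul σ i _ (1 + 6 * balance i l ^ 2)
          (fun o ho => by simp [pairSign, ho]) (by simp [pairSign]; ring)]
      ring
    rw [sum_listsOfLength_succ, sum_congr rfl fun l _ => h l, sum_add_distrib, sum_add_distrib,
      ih, ← sum_mul, ← sum_mul, sum_balance_sq hd, sum_chainWeight fun _ => sum_biasedLaw hd 0 σ]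
    push_cast
    ring

/-- The first absolute moment is bounded below in terms of the second and fourth moments through
`|y| ≥ (3 y² - y⁴) / 2`, scaled by `s`. -/
lemma le_abs_of_sq_of_pow_four (x : ℝ) {s : ℝ} (hs : 0 < s) :
    3 / (2 * s) * x ^ 2 - 1 / (2 * s ^ 3) * x ^ 4 ≤ |x| := by
  rw [← sq_abs x, show x ^ 4 = |x| ^ 4 from (Even.pow_abs (by decide) x).symm]
  obtain ⟨y, hy⟩ : ∃ y, |x| = s * y := ⟨|x| / s, by field_simp⟩
  have hy0 : 0 ≤ y := by
    by_contra! h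
    nlinarith [abs_nonneg x, mul_neg_of_pos_of_neg hs h]
  rw [hy]
  have : 3 / (2 * s) * (s * y) ^ 2 - 1 / (2 * s ^ 3) * (s * y) ^ 4 =
      s * ((3 * y ^ 2 - y ^ 4) / 2) := by
    field_simp
  rw [this]
  refine mul_le_mul_of_nonneg_left ?_ hs.le
  nlinarith [mul_nonneg hy0 (mul_nonneg (sq_nonneg (y - 1)) (by linarith : 0 ≤ y + 2))]

lemma sqrt_le_sum_abs_balance (hd : 2 ≤ d) {n : ℕ} (hn : d ≤ n) (σ : Fin (d / 2) → Bool)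
    (i : Fin (d / 2)) :
    1 / 2 * √(n / (d / 2 : ℕ)) ≤ ∑ l ∈ listsOfLength (Fin (d / 2) × Bool) n,
      chainWeight (fun _ => biasedLaw 0 σ) l * |balance i l| := by
  have hk : 0 < ((d / 2 : ℕ) : ℝ) := by
    have : 0 < d / 2 := by omega
    positivity
  have hkn : ((d / 2 : ℕ) : ℝ) ≤ n := by
    have : d / 2 ≤ n := by omega
    exact_mod_cast this
  set r := √((n : ℝ) / (d / 2 : ℕ)) with hr
  have hm : r ^ 2 = n / (d / 2 : ℕ) := Real.sq_sqrt (by positivity)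
  have hr1 : 1 ≤ r := Real.one_le_sqrt.2 ((one_le_div hk).2 hkn)
  have hr0 : 0 < r := by linarith
  have hw : ∀ l : List (Fin (d / 2) × Bool), 0 ≤ chainWeight (fun _ => biasedLaw 0 σ) l :=
    chainWeight_nonneg fun _ => biasedLaw_nonneg le_rfl (by norm_num) σ
  -- The balance has second moment `m = n / k` and fourth moment at most `4 m²`; the scale
  -- `s = 2 √m` is the best one for these values.
  have key := sum_le_sum fun l (_ : l ∈ listsOfLength (Fin (d / 2) × Bool) n) =>
    mul_le_mul_of_nonneg_left (le_abs_of_sq_of_pow_four (balance i l) (s := 2 * r) (by positivity))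
      (hw l)
  refine le_trans ?_ key
  simp only [mul_sub, sum_sub_distrib, mul_left_comm (chainWeight _ _), ← mul_sum]
  rw [sum_balance_sq hd, sum_balance_pow_four hd, ← hm]
  have h4 : (n : ℝ) / (d / 2 : ℕ) + 3 * n * (n - 1) / (d / 2 : ℕ) ^ 2 ≤ 4 * r ^ 4 := by
    have e : (n : ℝ) / (d / 2 : ℕ) + 3 * n * (n - 1) / (d / 2 : ℕ) ^ 2 =
        n / (d / 2 : ℕ) + 3 * (n / (d / 2 : ℕ)) ^ 2 - 3 * n / (d / 2 : ℕ) ^ 2 := by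
      field_simp
      ring
    have h0 : 0 ≤ 3 * (n : ℝ) / (d / 2 : ℕ) ^ 2 := by positivity
    rw [← hm] at e
    nlinarith [mul_nonneg (sq_nonneg r) (by nlinarith : 0 ≤ r ^ 2 - 1)]
  rw [← hm] at h4
  have h5 := mul_le_mul_of_nonneg_left h4 (by positivity : 0 ≤ 1 / (2 * (2 * r) ^ 3))
  have e1 : 3 / (2 * (2 * r)) * r ^ 2 = 3 / 4 * r := by field_simp; norm_num
  have e2 : 1 / (2 * (2 * r) ^ 3) * (4 * r ^ 4) = 1 / 4 * r := by field_simp; norm_num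
  rw [e2] at h5
  rw [e1]
  linarith

/-- In the unbiased environment every strategy suffers `n / 2`, whatever it observes, while the
best action gains half of the absolute balance in each pair. -/
theorem unbiased_lower_bound (hd : 2 ≤ d) {n : ℕ} (hn : d ≤ n) {g : Game}
    (F : Forecaster g (pairedActions d)) {M : ℝ}
    (hM : ∀ a ∈ obliviousAdversaries d ∩ L2Adversaries (pairedActions d),
      regret (pairedActions_nonempty d) F a n ≤ M) :
    0.05 * √((d : ℝ) * n) ≤ M := by
  have hk0 : 0 < d / 2 := by omega
  have hk : 0 < ((d / 2 : ℕ) : ℝ) := by positivity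
  have : Nonempty (Fin (d / 2) × Bool) := ⟨(⟨0, hk0⟩, true)⟩
  let σ : Fin (d / 2) → Bool := fun _ => true
  have hP1 := sum_biasedLaw hd 0 σ
  have hw : ∀ l : List (Fin (d / 2) × Bool), 0 ≤ chainWeight (fun _ => biasedLaw 0 σ) l :=
    chainWeight_nonneg fun _ => biasedLaw_nonneg le_rfl (by norm_num) σ
  have hreg := average_regret_le (pairedActions_nonempty d) F unitLoss_nonneg
    (fun o v _ => loss_unitLoss_le_one o v)
    (biasedLaw_nonneg le_rfl (by norm_num) σ) hP1 n hM
  have hmean : ∀ v : pairedActions d, meanLoss 0 σ v = 1 / 2 := fun v => by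
    simp [meanLoss_eq hd 0 σ v.2]
  rw [sum_joint_loss hd] at hreg
  simp only [hmean, ← sum_mul, sum_toReal_apply, one_mul,
    sum_chainWeight (sum_jointKernel F unitLoss hP1)] at hreg
  have hben : ∑ l ∈ listsOfLength (Fin (d / 2) × Bool) n,
      chainWeight (fun _ => biasedLaw 0 σ) l * (pairedActions d).inf' (pairedActions_nonempty d)
        (fun v => (l.map fun o => loss (unitLoss o) v).sum) ≤
      n / 2 - 1 / 2 * ∑ i, ∑ l ∈ listsOfLength (Fin (d / 2) × Bool) n,
        chainWeight (fun _ => biasedLaw 0 σ) l * |balance i l| := by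
    refine (sum_le_sum fun l hl =>
      mul_le_mul_of_nonneg_left (inf'_le_balance l) (hw l)).trans (le_of_eq ?_)
    rw [sum_comm, mul_sum]
    simp only [← mul_sum]
    rw [sum_congr rfl fun l hl => by rw [mem_listsOfLength.1 hl]]
    simp only [mul_sub, sum_sub_distrib, ← sum_mul, sum_chainWeight fun _ => hP1, one_mul,
      mul_left_comm (chainWeight _ _)]
    rw [← mul_sum]
  have habs := sum_le_sum fun i (_ : i ∈ univ) => sqrt_le_sum_abs_balance hd hn σ i
  rw [sum_const, card_univ, Fintype.card_fin, nsmul_eq_mul] at habs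
  have hsq : √((d : ℝ) * n) ≤ 2 * ((d / 2 : ℕ) * √((n : ℝ) / (d / 2 : ℕ))) := by
    refine Real.sqrt_le_iff.2 ⟨by positivity, ?_⟩
    rw [mul_pow, mul_pow, Real.sq_sqrt (by positivity)]
    have h3 : (d : ℝ) ≤ 3 * (d / 2 : ℕ) := by
      have : d ≤ 3 * (d / 2) := by omega
      exact_mod_cast this
    have e : (2 : ℝ) ^ 2 * ((d / 2 : ℕ) ^ 2 * (n / (d / 2 : ℕ))) = 4 * (d / 2 : ℕ) * n := by
      field_simp
      ring
    rw [e]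
    gcongr
    linarith
  simp only [sum_const, card_range, nsmul_eq_mul] at hreg
  have h0 := Real.sqrt_nonneg ((d : ℝ) * n)
  rw [show (0.05 : ℝ) = 1 / 20 by norm_num]
  linarith

/-! ### The biased environment in the bandit game -/

/-- What the bandit forecaster has seen when the losses of its actions are recorded as bits. -/
def seenBits (h : List (pairedActions d × Bool)) :
    List (pairedActions d × Game.bandit.Obs d) :=
  h.map fun p => (p.1, if p.2 then (1 : ℝ) else (0 : ℝ))

/-- The joint law of the next action and of its loss, recorded as a bit: given the action, the
loss is Bernoulli. -/
def banditKernel (F : Forecaster Game.bandit (pairedActions d)) (ε : ℝ) (σ : Fin (d / 2) → Bool)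
    (h : List (pairedActions d × Bool)) (p : pairedActions d × Bool) : ℝ :=
  (F (seenBits h) p.1).toReal * if p.2 then meanLoss ε σ p.1 else 1 - meanLoss ε σ p.1

/-- The action of a round and the bit that the bandit forecaster observes. -/
def observedBit (p : pairedActions d × (Fin (d / 2) × Bool)) : pairedActions d × Bool :=
  (p.1, (p.1 : Action d) (coord p.2.1 p.2.2))

lemma seen_eq_seenBits (z : List (pairedActions d × (Fin (d / 2) × Bool))) :
    seen Game.bandit unitLoss z = seenBits (z.map observedBit) := by
  rw [seen, seenBits, List.map_map]
  refine List.map_congr_left fun p _ => ?_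
  exact Prod.ext rfl (loss_unitLoss p.2 p.1)

lemma sum_jointKernel_observedBit (hd : 2 ≤ d) (F : Forecaster Game.bandit (pairedActions d))
    (ε : ℝ) (σ : Fin (d / 2) → Bool) (z : List (pairedActions d × (Fin (d / 2) × Bool)))
    (p : pairedActions d × Bool) :
    (∑ q with observedBit q = p, jointKernel F unitLoss (biasedLaw ε σ) z q) =
      banditKernel F ε σ (z.map observedBit) p := by
  obtain ⟨v, b⟩ := p
  rw [sum_filter, Fintype.sum_prod_type, sum_eq_single v]
  · simp only [observedBit, Prod.mk.injEq, true_and, jointKernel, banditKernel,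
      seen_eq_seenBits]
    simp only [← mul_ite_zero, ← mul_sum]
    congr 1
    have htrue : ∑ o, (if (v : Action d) (coord o.1 o.2) = true then biasedLaw ε σ o else 0) =
        meanLoss ε σ v := by
      simp [meanLoss, loss_unitLoss]
    cases b
    · rw [if_neg (by simp), ← htrue, ← sum_biasedLaw hd ε σ, ← sum_sub_distrib]
      refine sum_congr rfl fun o _ => ?_
      cases (v : Action d) (coord o.1 o.2) <;> simp
    · rw [if_pos rfl, ← htrue]
  · intro w _ hw
    simp [observedBit, hw]
  · simp

lemma meanLoss_mem (hd : 2 ≤ d) {ε : ℝ} (h0 : 0 ≤ ε) (h1 : ε ≤ 1 / 10)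
    (σ : Fin (d / 2) → Bool) {v : Action d} (hv : v ∈ pairedActions d) :
    2 / 5 ≤ meanLoss ε σ v ∧ meanLoss ε σ v ≤ 3 / 5 := by
  have hk : 0 < ((d / 2 : ℕ) : ℝ) := by
    have : 0 < d / 2 := by omega
    positivity
  have hs0 : 0 ≤ ∑ i, if choice v i = σ i then (0 : ℝ) else 1 :=
    sum_nonneg fun i _ => by split_ifs <;> norm_num
  have hs1 : (∑ i, if choice v i = σ i then (0 : ℝ) else 1) ≤ (d / 2 : ℕ) := by
    refine (sum_le_sum (g := fun _ => (1 : ℝ)) fun i _ => ?_).trans (by simp)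
    split_ifs <;> norm_num
  rw [meanLoss_eq hd ε σ hv]
  have hc : 0 ≤ 2 * ε / (d / 2 : ℕ) := by positivity
  have h2 := mul_le_mul_of_nonneg_left hs1 hc
  rw [div_mul_cancel₀ _ hk.ne'] at h2
  have h3 := mul_nonneg hc hs0
  constructor <;> linarith

lemma banditKernel_nonneg (hd : 2 ≤ d) (F : Forecaster Game.bandit (pairedActions d))
    {ε : ℝ} (h0 : 0 ≤ ε) (h1 : ε ≤ 1 / 10) (σ : Fin (d / 2) → Bool)
    (h : List (pairedActions d × Bool)) (p : pairedActions d × Bool) :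
    0 ≤ banditKernel F ε σ h p := by
  have := meanLoss_mem hd h0 h1 σ p.1.2
  refine mul_nonneg ENNReal.toReal_nonneg ?_
  split_ifs <;> linarith

lemma sum_banditKernel (F : Forecaster Game.bandit (pairedActions d)) (ε : ℝ)
    (σ : Fin (d / 2) → Bool) (h : List (pairedActions d × Bool)) :
    ∑ p, banditKernel F ε σ h p = 1 := by
  simp only [Fintype.sum_prod_type, banditKernel, ← mul_sum, Fintype.sum_bool, if_true,
    Bool.false_eq_true, if_false, add_sub_cancel, mul_one, sum_toReal_apply]

/-- The parameter `σ` with its `i`-th entry reversed. -/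
def flipAt (i : Fin (d / 2)) (σ : Fin (d / 2) → Bool) : Fin (d / 2) → Bool :=
  Function.update σ i (!σ i)

lemma flipAt_involutive (i : Fin (d / 2)) : Function.Involutive (flipAt i) := by
  intro σ
  funext j
  rcases eq_or_ne j i with rfl | h
  · simp [flipAt]
  · simp [flipAt, h]

lemma meanLoss_sub_flipAt_sq (hd : 2 ≤ d) (ε : ℝ) (σ : Fin (d / 2) → Bool) (i : Fin (d / 2))
    {v : Action d} (hv : v ∈ pairedActions d) :
    (meanLoss ε σ v - meanLoss ε (flipAt i σ) v) ^ 2 = (2 * ε / (d / 2 : ℕ)) ^ 2 := by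
  rw [meanLoss_eq hd ε σ hv, meanLoss_eq hd ε _ hv, add_sub_add_left_eq_sub, ← mul_sub,
    ← sum_sub_distrib, sum_eq_single i]
  · rw [mul_pow]
    cases h : choice v i <;> cases h' : σ i <;> simp [flipAt, h']
  · intro j _ hj
    simp [flipAt, hj]
  · simp

lemma le_banditKernel_affinity (hd : 2 ≤ d) (F : Forecaster Game.bandit (pairedActions d))
    {ε : ℝ} (h0 : 0 ≤ ε) (h1 : ε ≤ 1 / 10) (σ : Fin (d / 2) → Bool) (i : Fin (d / 2))
    (h : List (pairedActions d × Bool)) :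
    1 - 5 / 2 * (ε / (d / 2 : ℕ)) ^ 2 ≤
      ∑ p, √(banditKernel F ε σ h p * banditKernel F ε (flipAt i σ) h p) := by
  have e1 : ∀ c : ℝ, c = ∑ v, (F (seenBits h) v).toReal * c := fun c => by
    rw [← sum_mul, sum_toReal_apply, one_mul]
  rw [Fintype.sum_prod_type, e1 (1 - _)]
  refine sum_le_sum fun v _ => ?_
  have hp := meanLoss_mem hd h0 h1 σ v.2
  have hq := meanLoss_mem hd h0 h1 (flipAt i σ) v.2
  have haff := le_bernoulli_affinity hp.1 hp.2 hq.1 hq.2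
  rw [meanLoss_sub_flipAt_sq hd ε σ i v.2] at haff
  have hf : 0 ≤ (F (seenBits h) v).toReal := ENNReal.toReal_nonneg
  have e : ∀ x y : ℝ, √((F (seenBits h) v).toReal * x * ((F (seenBits h) v).toReal * y)) =
      (F (seenBits h) v).toReal * √(x * y) := by
    intro x y
    rw [mul_mul_mul_comm, Real.sqrt_mul (mul_nonneg hf hf), Real.sqrt_mul_self hf]
  simp only [Fintype.sum_bool, banditKernel, e, if_true, Bool.false_eq_true, if_false, ← mul_add]
  refine mul_le_mul_of_nonneg_left (le_trans (le_of_eq ?_) haff) hf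
  ring

/-- The probability that the action of round `t + 1` differs from `σ` in the pair `i`, when `σ` is
the parameter of the environment. -/
def errorProb (F : Forecaster Game.bandit (pairedActions d)) (ε : ℝ) (t : ℕ) (i : Fin (d / 2))
    (σ : Fin (d / 2) → Bool) : ℝ :=
  ∑ h ∈ listsOfLength (pairedActions d × Bool) t, chainWeight (banditKernel F ε σ) h *
    ∑ v, (F (seenBits h) v).toReal * if choice (v : Action d) i = σ i then 0 else 1

/-- Guessing the `i`-th entry of `σ` by the choice in the pair `i` is a test between `σ` and
`flipAt i σ`. -/
lemma le_errorProb_add_errorProb_flipAt (hd : 2 ≤ d)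
    (F : Forecaster Game.bandit (pairedActions d)) {ε : ℝ} (h0 : 0 ≤ ε) (h1 : ε ≤ 1 / 10) (t : ℕ)
    (i : Fin (d / 2)) (σ : Fin (d / 2) → Bool) :
    3 / 4 - 15 / 8 * (t * (5 / 2 * (ε / (d / 2 : ℕ)) ^ 2)) ≤
      errorProb F ε t i σ + errorProb F ε t i (flipAt i σ) := by
  have hk : 1 ≤ ((d / 2 : ℕ) : ℝ) := by
    have : 1 ≤ d / 2 := by omega
    exact_mod_cast this
  have hη : 5 / 2 * (ε / (d / 2 : ℕ)) ^ 2 ≤ 1 := by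
    have h2 : ε / (d / 2 : ℕ) ≤ ε := div_le_self h0 hk
    have h3 : 0 ≤ ε / (d / 2 : ℕ) := by positivity
    nlinarith
  refine (le_sum_errors (banditKernel_nonneg hd F h0 h1 σ)
    (banditKernel_nonneg hd F h0 h1 (flipAt i σ)) (sum_banditKernel F ε σ)
    (sum_banditKernel F ε (flipAt i σ)) hη (le_banditKernel_affinity hd F h0 h1 σ i)
    (φ := fun h => ∑ v, (F (seenBits h) v).toReal *
      if choice (v : Action d) i = σ i then 0 else 1) (fun h => ?_) (fun h => ?_) t).trans
    (le_of_eq ?_)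
  · refine sum_nonneg fun v _ => mul_nonneg ENNReal.toReal_nonneg ?_
    split_ifs <;> norm_num
  · refine (sum_le_sum fun v _ => mul_le_of_le_one_right ENNReal.toReal_nonneg ?_).trans_eq
      (sum_toReal_apply (F (seenBits h)))
    split_ifs <;> norm_num
  · rw [errorProb, errorProb]
    congr 1
    refine sum_congr rfl fun h _ => ?_
    congr 1
    have e1 : ∀ c : pairedActions d → ℝ, 1 - ∑ v, (F (seenBits h) v).toReal * c v =
        ∑ v, (F (seenBits h) v).toReal * (1 - c v) := fun c => by
      simp only [mul_sub, sum_sub_distrib, mul_one, sum_toReal_apply]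
    rw [e1]
    refine sum_congr rfl fun v _ => ?_
    cases hc : choice (v : Action d) i <;> cases hs : σ i <;> simp [flipAt, hs]

/-- In the environment with parameter `σ`, the regret against the action `σ` counts the errors of
the forecaster. -/
lemma sum_errorProb_le (hd : 2 ≤ d) {n : ℕ} (F : Forecaster Game.bandit (pairedActions d))
    {ε : ℝ} (h0 : 0 ≤ ε) (h1 : ε ≤ 1 / 10) {M : ℝ}
    (hM : ∀ a ∈ obliviousAdversaries d ∩ L2Adversaries (pairedActions d),
      regret (pairedActions_nonempty d) F a n ≤ M) (σ : Fin (d / 2) → Bool) :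
    2 * ε / (d / 2 : ℕ) * ∑ t ∈ range n, ∑ i, errorProb F ε t i σ ≤ M := by
  have hk0 : 0 < d / 2 := by omega
  have : Nonempty (Fin (d / 2) × Bool) := ⟨(⟨0, hk0⟩, true)⟩
  have hP1 := sum_biasedLaw hd ε σ
  have hw : ∀ l : List (Fin (d / 2) × Bool), 0 ≤ chainWeight (fun _ => biasedLaw ε σ) l :=
    chainWeight_nonneg fun _ => biasedLaw_nonneg h0 h1 σ
  have hreg := average_regret_le (pairedActions_nonempty d) F unitLoss_nonneg
    (fun o v _ => loss_unitLoss_le_one o v) (biasedLaw_nonneg h0 h1 σ) hP1 n hM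
  rw [sum_joint_loss hd] at hreg
  have hben : ∑ l ∈ listsOfLength (Fin (d / 2) × Bool) n,
      chainWeight (fun _ => biasedLaw ε σ) l * (pairedActions d).inf' (pairedActions_nonempty d)
        (fun v => (l.map fun o => loss (unitLoss o) v).sum) ≤ n * (1 / 2 - ε) := by
    obtain ⟨v, hv, hσ⟩ := exists_choice_eq σ
    refine (sum_le_sum fun l _ => mul_le_mul_of_nonneg_left
      (inf'_le (fun v => (l.map fun o => loss (unitLoss o) v).sum) hv) (hw l)).trans (le_of_eq ?_)
    rw [sum_chainWeight_mul_sum (κ := fun _ => biasedLaw ε σ) (fun _ => hP1)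
      fun o => loss (unitLoss o) v]
    have : ∑ o, biasedLaw ε σ o * loss (unitLoss o) v = 1 / 2 - ε := by
      have := meanLoss_eq hd ε σ hv
      rw [meanLoss, hσ] at this
      simpa using this
    simp only [this, ← sum_mul, sum_chainWeight fun _ => hP1, one_mul]
    rw [sum_const, card_range, nsmul_eq_mul]
  have hloss : ∀ t, ∑ z ∈ listsOfLength (pairedActions d × (Fin (d / 2) × Bool)) t,
        chainWeight (jointKernel F unitLoss (biasedLaw ε σ)) z *
          ∑ v, (F (seen Game.bandit unitLoss z) v).toReal * meanLoss ε σ v =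
      1 / 2 - ε + 2 * ε / (d / 2 : ℕ) * ∑ i, errorProb F ε t i σ := by
    intro t
    simp only [seen_eq_seenBits]
    rw [sum_chainWeight_map observedBit (sum_jointKernel_observedBit hd F ε σ) t
      fun h => ∑ v, (F (seenBits h) v).toReal * meanLoss ε σ v]
    have e : ∀ h : List (pairedActions d × Bool),
        ∑ v, (F (seenBits h) v).toReal * meanLoss ε σ v =
        1 / 2 - ε + 2 * ε / (d / 2 : ℕ) * ∑ i, ∑ v : pairedActions d, (F (seenBits h) v).toReal *
          if choice (v : Action d) i = σ i then 0 else 1 := by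
      intro h
      have e1 : ∀ c : ℝ, c = ∑ v, (F (seenBits h) v).toReal * c := fun c => by
        rw [← sum_mul, sum_toReal_apply, one_mul]
      rw [sum_comm, mul_sum, e1 (1 / 2 - ε), ← sum_add_distrib]
      refine sum_congr rfl fun v _ => ?_
      rw [meanLoss_eq hd ε σ v.2, ← mul_sum]
      ring
    simp only [e, mul_add, sum_add_distrib, ← sum_mul, sum_chainWeight (sum_banditKernel F ε σ),
      one_mul, errorProb]
    rw [sum_comm]
    simp only [mul_left_comm (chainWeight _ _), ← mul_sum]
  simp only [hloss, sum_add_distrib, ← mul_sum] at hreg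
  simp only [sum_const, card_range, nsmul_eq_mul] at hreg
  linarith

/-- Each choice that differs from `σ` costs `2 ε / k`, and with `ε = min (1/10) (3 k / (10 √n))` a
quarter of the choices do on average, for a total of `ε n / 2`. -/
theorem bandit_lower_bound (hd : 2 ≤ d) {n : ℕ} (hn : 0 < n)
    (F : Forecaster Game.bandit (pairedActions d)) {M : ℝ}
    (hM : ∀ a ∈ obliviousAdversaries d ∩ L2Adversaries (pairedActions d),
      regret (pairedActions_nonempty d) F a n ≤ M) :
    0.05 * min (n : ℝ) (d * √n) ≤ M := by
  have hk : 0 < ((d / 2 : ℕ) : ℝ) := by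
    have : 0 < d / 2 := by omega
    positivity
  have hn0 : 0 < (n : ℝ) := Nat.cast_pos.2 hn
  have hs : 0 < √(n : ℝ) := Real.sqrt_pos.2 hn0
  have hs2 : √(n : ℝ) ^ 2 = n := Real.sq_sqrt hn0.le
  -- The bias is as large as `n` rounds allow it to be without revealing `σ`.
  set ε : ℝ := min (1 / 10) (3 / 10 * (d / 2 : ℕ) / √n) with hε
  have h0 : 0 ≤ ε := by positivity
  have h1 : ε ≤ 1 / 10 := min_le_left _ _
  have hη : n * (ε / (d / 2 : ℕ)) ^ 2 ≤ 9 / 100 := by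
    have h2 : ε / (d / 2 : ℕ) * √n ≤ 3 / 10 := by
      have : ε ≤ 3 / 10 * (d / 2 : ℕ) / √n := min_le_right _ _
      rw [le_div_iff₀ hs] at this
      rw [div_mul_eq_mul_div, div_le_iff₀ hk]
      exact this
    have h3 : 0 ≤ ε / (d / 2 : ℕ) * √n := by positivity
    nlinarith
  have hmin : min (n : ℝ) (d * √n) ≤ 10 * (ε * n) := by
    have h3 : (d : ℝ) ≤ 3 * (d / 2 : ℕ) := by
      have : d ≤ 3 * (d / 2) := by omega
      exact_mod_cast this
    rcases min_choice (1 / 10 : ℝ) (3 / 10 * (d / 2 : ℕ) / √n) with h | h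
    · rw [hε, h]
      exact (min_le_left _ _).trans (by linarith)
    · rw [hε, h]
      refine (min_le_right _ _).trans ?_
      have : 10 * (3 / 10 * ((d / 2 : ℕ) : ℝ) / √n * n) = 3 * (d / 2 : ℕ) * √n := by
        rw [← hs2]
        field_simp
        simp [hs2]
      rw [this]
      gcongr
  -- On average over `σ`, the error in the pair `i` is half of the sum of the errors for `σ` and for
  -- `flipAt i σ`.
  have hpair : ∀ t ∈ range n, ∀ i ∈ (univ : Finset (Fin (d / 2))),
      (Fintype.card (Fin (d / 2) → Bool) : ℝ) * (3 / 4 - 75 / 16 * (ε / (d / 2 : ℕ)) ^ 2 * t) ≤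
        2 * ∑ σ, errorProb F ε t i σ := by
    intro t _ i _
    have hflip : ∑ σ, errorProb F ε t i (flipAt i σ) = ∑ σ, errorProb F ε t i σ :=
      Equiv.sum_comp (flipAt_involutive i).toPerm fun σ => errorProb F ε t i σ
    have h := sum_le_sum fun σ (_ : σ ∈ univ) =>
      le_errorProb_add_errorProb_flipAt hd F h0 h1 t i σ
    rw [sum_const, card_univ, nsmul_eq_mul, sum_add_distrib, hflip, ← two_mul] at h
    refine le_trans (le_of_eq ?_) h
    ring
  have hsum := sum_le_sum fun t ht => sum_le_sum (hpair t ht)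
  have hgauss : ∀ m : ℕ, ∑ t ∈ range m, (t : ℝ) = m * (m - 1) / 2 := by
    intro m
    induction m with
    | zero => simp
    | succ m ih =>
      rw [sum_range_succ, ih]
      push_cast
      ring
  have havg := sum_le_sum fun σ (_ : σ ∈ univ) => sum_errorProb_le hd F h0 h1 hM σ
  rw [sum_const, card_univ, nsmul_eq_mul, ← mul_sum, sum_comm] at havg
  simp only [sum_comm (s := (univ : Finset (Fin (d / 2) → Bool)))] at havg
  simp only [sum_const, card_univ, Fintype.card_fin, nsmul_eq_mul, ← mul_sum, sum_sub_distrib,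
    card_range, hgauss] at hsum
  set C : ℝ := (Fintype.card (Fin (d / 2) → Bool) : ℝ) with hC
  have hC0 : 0 < C := by
    rw [hC]
    exact_mod_cast Fintype.card_pos
  set E : ℝ := ∑ t ∈ range n, ∑ i, ∑ σ, errorProb F ε t i σ
  have hE := mul_le_mul_of_nonneg_left hsum (by positivity : 0 ≤ ε / (d / 2 : ℕ))
  have e1 : ε / (d / 2 : ℕ) * (2 * E) = 2 * ε / (d / 2 : ℕ) * E := by ring
  have e2 : ε / (d / 2 : ℕ) * ((d / 2 : ℕ) * (C * (n * (3 / 4) -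
      75 / 16 * (ε / (d / 2 : ℕ)) ^ 2 * (n * (n - 1) / 2)))) =
      C * (ε * (n * (3 / 4) - 75 / 16 * (ε / (d / 2 : ℕ)) ^ 2 * (n * (n - 1) / 2))) := by
    field_simp
  rw [e1, e2] at hE
  have hM' := le_of_mul_le_mul_left (hE.trans havg) hC0
  have hnum : (n : ℝ) / 2 ≤
      n * (3 / 4) - 75 / 16 * (ε / (d / 2 : ℕ)) ^ 2 * (n * (n - 1) / 2) := by
    have h3 := mul_le_mul_of_nonneg_left hη hn0.le
    have h4 : 0 ≤ n * (ε / (d / 2 : ℕ)) ^ 2 := by positivity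
    nlinarith
  have h5 := mul_le_mul_of_nonneg_left hnum h0
  rw [show (0.05 : ℝ) = 1 / 20 by norm_num]
  linarith

end CombGame
end

theorem mainTheorem3 (d n : ℕ) (hd : 2 ≤ d) (hn : d ≤ n)
    (A : Set (CombGame.Adversary d)) (hA : CombGame.obliviousAdversaries d ⊆ A) :
    ((0.05 * Real.sqrt ((d : ℝ) * (n : ℝ)) : ℝ) : EReal)
        ≤ CombGame.maximalMinimaxRegret CombGame.Game.fullInfo d n A ∧
    ((0.05 * Real.sqrt ((d : ℝ) * (n : ℝ)) : ℝ) : EReal)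
        ≤ CombGame.maximalMinimaxRegret CombGame.Game.semiBandit d n A ∧
    ((0.05 * min (n : ℝ) ((d : ℝ) * Real.sqrt (n : ℝ)) : ℝ) : EReal)
        ≤ CombGame.maximalMinimaxRegret CombGame.Game.bandit d n A :=
  ⟨CombGame.le_maximalMinimaxRegret hA (CombGame.pairedActions_nonempty d)
      fun F _ hM => CombGame.unbiased_lower_bound hd hn F hM,
    CombGame.le_maximalMinimaxRegret hA (CombGame.pairedActions_nonempty d)
      fun F _ hM => CombGame.unbiased_lower_bound hd hn F hM,
    CombGame.le_maximalMinimaxRegret hA (CombGame.pairedActions_nonempty d)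
      fun F _ hM => CombGame.bandit_lower_bound hd (by omega) F hM⟩
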